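/- A standard probability space is a standard Borel space with a probability measure. An action of a countable group $\Gamma$ on a standard probability space $(X,\mu)$ is an action by Borel automorphisms that is non-singular (every $s\in\Gamma$ preserves the $\mu$-null sets); it is essentially free if $\mu(\{x\in X : sx=x\})=0$ for all $s\in\Gamma\setminus\{e\}$. A factor map $\pi\colon (Y,\nu)\to(X,\mu)$ between two such actions is a measurable map such that $\pi_*\nu$ and $\mu$ have the same null sets and, for every $s\in\Gamma$, $\pi(sy)=s\pi(y)$ for $\nu$-a.e. $y\in Y$. An intermediate extension of $\pi$ consists of an action of $\Gamma$ on a standard probability space $(Z,\zeta)$ and factor maps $p\colon Y\to Z$, $q\colon Z\to X$ with $q\circ p=\pi$ a.e. Via $f\mapsto f\circ\pi$ and $f\mapsto f\circ p$ one regards $L^\infty(X)\subset L^\infty(Z)\subset L^\infty(Y)$ as $\Gamma$-invariant von Neumann subalgebras. The crossed product $L^\infty(Y)\rtimes\Gamma$ is the von Neumann algebra on $\ell^2(\Gamma)\otimes L^2(Y,\nu)$ generated by the operators $(g\xi)(t,y)=g(ty)\,\xi(t,y)$, $g\in L^\infty(Y)$, and the unitaries $(u_s\xi)(t,y)=\xi(s^{-1}t,y)$,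 $s\in\Gamma$; for a $\Gamma$-invariant von Neumann subalgebra $N\subset L^\infty(Y)$, $N\rtimes\Gamma\subset L^\infty(Y)\rtimes\Gamma$ is the von Neumann subalgebra generated by $N$ and $\{u_s : s\in\Gamma\}$. \textbf{Proposition.} Let $\Gamma$ be a countable group and let $\alpha\colon\Gamma\curvearrowright(X,\mu)$ be a (non-singular) action on a standard probability space which is not essentially free. Then there are an essentially free (non-singular) action $\beta\colon\Gamma\curvearrowright(Y,\nu)$ on a standard probability space and a factor map $\pi\colon Y\to X$ with the following property: there is a von Neumann algebra $M$ with \[ L^\infty(X)\rtimes\Gamma\subset M\subset L^\infty(Y)\rtimes\Gamma \] such that $M\neq L^\infty(Z)\rtimes\Gamma$ for every intermediate extension $Z$ of $\pi$. -/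

import Mathlib

open MeasureTheory
open scoped ENNReal

universe u v w

noncomputable section

namespace CrossedProduct

/-! ### Measurable dynamics

A standard probability space is a standard Borel space with a probability measure.  All statements
about maps between such spaces are up to null sets. -/

/-- The action of `Γ` on `(X, μ)` is non-singular: each group element acts by a measurable map
preserving null sets under preimages (applied to `s` and `s⁻¹`, this says that every `s` acts by a
Borel isomorphism preserving the class of `μ`). -/
def IsNonsingular (Γ : Type u) {X : Type v} [Group Γ] [MulAction Γ X] [MeasurableSpace X]
    (μ : Measure X) : Prop :=
  ∀ s : Γ, Measure.QuasiMeasurePreserving (fun x : X => s • x) μ μ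

/-- The action of `Γ` on `(X, μ)` is essentially free: every non-trivial group element has a null
set of fixed points. -/
def IsEssentiallyFree (Γ : Type u) {X : Type v} [Group Γ] [MulAction Γ X] [MeasurableSpace X]
    (μ : Measure X) : Prop :=
  ∀ s : Γ, s ≠ 1 → μ {x : X | s • x = x} = 0

/-- `π : (Y, ν) → (X, μ)` is a factor map: it is measurable, preserves the measure class
(`π_* ν` and `μ` have the same null sets), and is `Γ`-equivariant up to null sets. -/
structure IsFactorMap (Γ : Type u) {Y : Type v} {X : Type w} [Group Γ]
    [MulAction Γ Y] [MulAction Γ X] [MeasurableSpace Y] [MeasurableSpace X]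
    (π : Y → X) (ν : Measure Y) (μ : Measure X) : Prop where
  measurable : Measurable π
  map_absolutelyContinuous : ν.map π ≪ μ
  absolutelyContinuous_map : μ ≪ ν.map π
  equivariant : ∀ s : Γ, ∀ᵐ y ∂ν, π (s • y) = s • π y

/-! ### Crossed product von Neumann algebras -/

/-- The von Neumann algebra on `H` generated by a set `S` of bounded operators: the bicommutant of
`S ∪ S*`. -/
def generated {H : Type u} [NormedAddCommGroup H] [InnerProductSpace ℂ H] [CompleteSpace H]
    (S : Set (H →L[ℂ] H)) : VonNeumannAlgebra H where
  toStarSubalgebra :=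
    StarSubalgebra.centralizer ℂ (StarSubalgebra.centralizer ℂ S : Set (H →L[ℂ] H))
  centralizer_centralizer' := by
    have h : (StarSubalgebra.centralizer ℂ
        (StarSubalgebra.centralizer ℂ S : Set (H →L[ℂ] H))).carrier
        = Set.centralizer (Set.centralizer (S ∪ star S)) :=
      StarSubalgebra.coe_centralizer_centralizer ℂ S
    rw [h, Set.centralizer_centralizer_centralizer]

/-- The multiplication operator `ξ ↦ F ξ` on `L²(Ω, m)` for `F ∈ L^∞(Ω, m)`. -/
def mulOp {Ω : Type u} [MeasurableSpace Ω] {m : Measure Ω} (F : Lp ℂ ∞ m) :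
    Lp ℂ 2 m →L[ℂ] Lp ℂ 2 m :=
  (ContinuousLinearMap.mul ℂ ℂ).holderL m ∞ 2 2 F

variable (Γ : Type u) {Y : Type v} {Z : Type w}

/-- The Hilbert space `ℓ²(Γ) ⊗ L²(Y, ν)`, realised as `L²(Γ × Y)` with respect to the product of the
counting measure and `ν`. -/
abbrev HilbertSpace [MeasurableSpace Γ] [MeasurableSpace Y] (ν : Measure Y) : Type (max u v) :=
  Lp ℂ 2 ((Measure.count : Measure Γ).prod ν)

/-- The set of operators `ξ ↦ ((t, y) ↦ g (t • y) ξ (t, y))` on `L²(Γ × Y)`, with `g ∈ N`.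
As `g (t • y) = (β_{t⁻¹} g) (y)`, this is the image of `N ⊆ L^∞(Y)` under the usual regular
representation `(π_β(g) ξ)(t) = β_{t⁻¹}(g) ξ(t)`. -/
def coefficientOps [Group Γ] [MeasurableSpace Γ] [MeasurableSpace Y] [MulAction Γ Y]
    (ν : Measure Y) (N : Set (Lp ℂ ∞ ν)) :
    Set (HilbertSpace Γ ν →L[ℂ] HilbertSpace Γ ν) :=
  {T | ∃ g ∈ N, ∃ F : Lp ℂ ∞ ((Measure.count : Measure Γ).prod ν),
    (F =ᵐ[(Measure.count : Measure Γ).prod ν] fun z : Γ × Y => g (z.1 • z.2)) ∧ T = mulOp F}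

theorem measurePreserving_translate {Γ : Type u} [Group Γ] [Countable Γ] [MeasurableSpace Γ]
    [DiscreteMeasurableSpace Γ] [MeasurableSpace Y] (ν : Measure Y) [SFinite ν] (s : Γ) :
    MeasurePreserving (fun z : Γ × Y => (s⁻¹ * z.1, z.2))
      ((Measure.count : Measure Γ).prod ν) ((Measure.count : Measure Γ).prod ν) :=
  (measurePreserving_mul_left (Measure.count : Measure Γ) s⁻¹).prod (MeasurePreserving.id ν)

/-- The implementing unitary `u_s = λ_s ⊗ 1`: `(u_s ξ)(t, y) = ξ(s⁻¹ t, y)`. -/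
def translationOp {Γ : Type u} [Group Γ] [Countable Γ] [MeasurableSpace Γ]
    [DiscreteMeasurableSpace Γ] [MeasurableSpace Y] (ν : Measure Y) [SFinite ν] (s : Γ) :
    HilbertSpace Γ ν →L[ℂ] HilbertSpace Γ ν :=
  (Lp.compMeasurePreservingₗᵢ ℂ (fun z : Γ × Y => (s⁻¹ * z.1, z.2))
    (measurePreserving_translate ν s)).toContinuousLinearMap

/-- The crossed product `N ⋊ Γ` of a `Γ`-invariant von Neumann subalgebra `N ⊆ L^∞(Y, ν)`, as a von
Neumann subalgebra of `L^∞(Y, ν) ⋊ Γ` acting on `ℓ²(Γ) ⊗ L²(Y, ν)`: it is generated by the copy of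
`N` and the implementing unitaries. -/
def crossedProduct [Group Γ] [Countable Γ] [MeasurableSpace Γ] [DiscreteMeasurableSpace Γ]
    [MeasurableSpace Y] [MulAction Γ Y] (ν : Measure Y) [SFinite ν] (N : Set (Lp ℂ ∞ ν)) :
    VonNeumannAlgebra (HilbertSpace Γ ν) :=
  generated (coefficientOps Γ ν N ∪ Set.range (translationOp (Γ := Γ) ν))

/-- `L^∞(Z, ζ)` regarded as a subalgebra of `L^∞(Y, ν)` via `p : Y → Z`, that is `{f ∘ p}`. -/
def pullbackLinfty [MeasurableSpace Y] [MeasurableSpace Z] (ν : Measure Y) (ζ : Measure Z)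
    (p : Y → Z) : Set (Lp ℂ ∞ ν) :=
  {g | ∃ f : Lp ℂ ∞ ζ, g =ᵐ[ν] fun y => f (p y)}

end CrossedProduct

end

open CrossedProduct

set_option linter.unusedSectionVars false

noncomputable section

namespace CrossedProduct

/-! ### Generated von Neumann algebras -/

section Generated

variable {H : Type*} [NormedAddCommGroup H] [InnerProductSpace ℂ H] [CompleteSpace H]

/-! Some `s ≠ 1` fixes pointwise a set `F` of positive measure. Let `Y = X × Γ × Bool`, with `Γ`
translating the middle factor on the left and `π (x, y, i) = y • x`; this action is free.

On `L²(Γ × Y)`, with points `(t, ((x, y), i))`, consider two involutions supported over `x ∈ F`: θ₀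
(`sheetFlip`) changes only `i`, while θ₁ (`twistedFlip`) also replaces `t * y` by `t * y * s` or `t
* y * s⁻¹`, according to `i`. Functions from `L^∞(X)` depend only on `(t * y) • x`, so both
composition operators commute with `L^∞(X) ⋊ Γ`. An element `w` of the full group (`conjugator`)
exchanges θ₀ and θ₁ by conjugation; its composition operator lies in `L^∞(Y) ⋊ Γ`
(`compOp_mem_crossedProduct`). Let `M` be generated by `L^∞(X) ⋊ Γ` and `w`. Then `M` commutes with
the sum of the two composition operators (`commute_intermediateAlgebra`).

If `M` were `N ⋊ Γ`, then `N` would commute with this sum, hence with θ₀ alone: θ₀ preserves the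
fibres `{t} × Y` and θ₁ leaves them over `F`, so the two terms separate
(`ae_eq_of_add_compOp_commute_mulOp`). So θ₀ would commute with `N ⋊ Γ = M`, in particular with `w`,
which fails over `F`. -/

theorem mem_generated_iff {S : Set (H →L[ℂ] H)} {x : H →L[ℂ] H} :
    x ∈ generated S ↔ ∀ V ∈ StarSubalgebra.centralizer ℂ S, V * x = x * V := by
  change x ∈ StarSubalgebra.centralizer ℂ
    (StarSubalgebra.centralizer ℂ S : Set (H →L[ℂ] H)) ↔ _
  rw [StarSubalgebra.mem_centralizer_iff]
  exact ⟨fun h V hV => (h V hV).1, fun h V hV => ⟨h V hV, h _ (star_mem hV)⟩⟩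

theorem subset_generated (S : Set (H →L[ℂ] H)) {x : H →L[ℂ] H} (hx : x ∈ S) :
    x ∈ generated S :=
  mem_generated_iff.2 fun _ hV => ((StarSubalgebra.mem_centralizer_iff ℂ).1 hV x hx).1.symm

theorem generated_mono {S T : Set (H →L[ℂ] H)} (h : S ⊆ T) : generated S ≤ generated T :=
  fun _ hx => mem_generated_iff.2 fun V hV =>
    mem_generated_iff.1 hx V (StarSubalgebra.centralizer_le ℂ S T h hV)

theorem generated_le_generated {S T : Set (H →L[ℂ] H)} (h : ∀ x ∈ S, x ∈ generated T) :
    generated S ≤ generated T := by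
  intro x hx
  refine mem_generated_iff.2 fun V hV => mem_generated_iff.1 hx V ?_
  refine (StarSubalgebra.mem_centralizer_iff ℂ).2 fun g hg => ⟨?_, ?_⟩
  · exact (mem_generated_iff.1 (h g hg) V hV).symm
  · exact (mem_generated_iff.1 (star_mem (h g hg)) V hV).symm

/-- A self-adjoint operator commuting with `S` commutes with the von Neumann algebra generated
by `S`. -/
theorem commute_of_mem_generated {S : Set (H →L[ℂ] H)} {T x : H →L[ℂ] H}
    (hT : IsSelfAdjoint T) (h : ∀ g ∈ S, T * g = g * T) (hx : x ∈ generated S) :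
    T * x = x * T := by
  refine mem_generated_iff.1 hx T ((StarSubalgebra.mem_centralizer_iff ℂ).2 fun g hg =>
    ⟨(h g hg).symm, ?_⟩)
  have := congrArg star (h g hg)
  simpa [star_mul, hT.star_eq] using this

end Generated

/-! ### Composition and multiplication operators -/

section Operators

variable {Ω : Type*} [MeasurableSpace Ω] {m : Measure Ω}

/-- The composition operator `ξ ↦ ξ ∘ θ` on `L²(Ω, m)` for a measure preserving map `θ`. -/
def compOp (θ : Ω → Ω) (hθ : MeasurePreserving θ m m) : Lp ℂ 2 m →L[ℂ] Lp ℂ 2 m :=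
  (Lp.compMeasurePreservingₗᵢ ℂ θ hθ).toContinuousLinearMap

theorem coeFn_compOp {θ : Ω → Ω} (hθ : MeasurePreserving θ m m) (ξ : Lp ℂ 2 m) :
    compOp θ hθ ξ =ᵐ[m] fun z => ξ (θ z) :=
  Lp.coeFn_compMeasurePreserving ξ hθ

theorem coeFn_mulOp (F : Lp ℂ ∞ m) (ξ : Lp ℂ 2 m) :
    mulOp F ξ =ᵐ[m] fun z => F z * ξ z :=
  (ContinuousLinearMap.mul ℂ ℂ).coeFn_holder (r := 2) F ξ

/-- Composition operators multiply contravariantly. The separate `κ` lets a pointwise identity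
between two composites become an operator identity. -/
theorem compOp_mul_compOp {θ η κ : Ω → Ω} (hθ : MeasurePreserving θ m m)
    (hη : MeasurePreserving η m m) (hκ : MeasurePreserving κ m m) (h : ∀ z, η (θ z) = κ z) :
    compOp θ hθ * compOp η hη = compOp κ hκ := by
  ext1 ξ
  apply Lp.ext
  change (compOp θ hθ (compOp η hη ξ) : Ω → ℂ) =ᵐ[m] _
  filter_upwards [coeFn_compOp hθ (compOp η hη ξ), coeFn_compOp hκ ξ,
    hθ.quasiMeasurePreserving.ae (coeFn_compOp hη ξ)] with z h1 h2 h3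
  rw [h1, h2, h3, h]

theorem compOp_id : compOp (id : Ω → Ω) (MeasurePreserving.id m) = 1 := by
  ext1 ξ
  apply Lp.ext
  filter_upwards [coeFn_compOp (MeasurePreserving.id m) ξ] with z h1
  rw [h1]; rfl

/-- The operator is an isometry `U` with `U² = 1`, so `⟨Uξ, η⟩ = ⟨Uξ, U(Uη)⟩ = ⟨ξ, Uη⟩`. -/
theorem isSelfAdjoint_compOp {θ : Ω → Ω} (hθ : MeasurePreserving θ m m)
    (h : Function.Involutive θ) : IsSelfAdjoint (compOp θ hθ) := by
  rw [ContinuousLinearMap.isSelfAdjoint_iff_isSymmetric]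
  intro ξ η
  have hsq : compOp θ hθ (compOp θ hθ η) = η := by
    have := compOp_mul_compOp hθ hθ (MeasurePreserving.id m) h
    rw [compOp_id] at this
    exact congrArg (fun T => T η) this
  have := (Lp.compMeasurePreservingₗᵢ ℂ θ hθ (p := 2) (E := ℂ)).inner_map_map ξ (compOp θ hθ η)
  change inner ℂ (compOp θ hθ ξ) (compOp θ hθ (compOp θ hθ η)) = _ at this
  rw [hsq] at this
  exact this

theorem compOp_commute_mulOp {θ : Ω → Ω} (hθ : MeasurePreserving θ m m) {F : Lp ℂ ∞ m}
    (h : ∀ᵐ z ∂m, F (θ z) = F z) : compOp θ hθ * mulOp F = mulOp F * compOp θ hθ := by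
  ext1 ξ
  apply Lp.ext
  change (compOp θ hθ (mulOp F ξ) : Ω → ℂ) =ᵐ[m] (mulOp F (compOp θ hθ ξ) : Ω → ℂ)
  filter_upwards [coeFn_compOp hθ (mulOp F ξ), hθ.quasiMeasurePreserving.ae (coeFn_mulOp F ξ),
    coeFn_mulOp F (compOp θ hθ ξ), coeFn_compOp hθ ξ, h] with z h1 h2 h3 h4 h5
  rw [h1, h2, h3, h4, h5]

theorem memLp_top_indicator_one (m : Measure Ω) {A : Set Ω} (hA : MeasurableSet A) :
    MemLp (A.indicator fun _ => (1 : ℂ)) ∞ m :=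
  memLp_top_of_bound ((measurable_const.indicator hA).aestronglyMeasurable) 1
    (ae_of_all _ fun x => by by_cases h : x ∈ A <;> simp [h])

end Operators

/-! ### Operators on `L²(Γ × Y)` -/

section Fibred

variable {Γ : Type u} [MeasurableSpace Γ] [DiscreteMeasurableSpace Γ]

theorem map_count_perm {α : Type*} [MeasurableSpace α] [DiscreteMeasurableSpace α]
    (e : Equiv.Perm α) :
    (Measure.count : Measure α).map e = Measure.count := by
  ext A hA
  rw [Measure.map_apply (Measurable.of_discrete) hA, Measure.count_apply hA,
    Measure.count_apply (.of_discrete), Set.encard_preimage_of_bijective e.bijective]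

variable [Countable Γ] {Y : Type v} [MeasurableSpace Y] {ν : Measure Y}

variable (Γ ν) in
/-- The product of the counting measure of `Γ` and `ν`. -/
abbrev countProd : Measure (Γ × Y) := (Measure.count : Measure Γ).prod ν

/-- A map of `Γ × Y` covering a measure preserving map of `Y` and permuting the fibres preserves the
product of the counting measure with the measure of `Y`. -/
theorem measurePreserving_fibred [SFinite ν] {f : Y → Y} (hf : MeasurePreserving f ν ν)
    (e : Y → Equiv.Perm Γ) (he : ∀ t, Measurable fun y => e y t) :
    MeasurePreserving (fun z : Γ × Y => (e z.2 z.1, f z.2))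
      (countProd Γ ν) (countProd Γ ν) := by
  have hskew : MeasurePreserving (fun p : Y × Γ => (f p.1, e p.1 p.2))
      (ν.prod Measure.count) (ν.prod Measure.count) :=
    hf.skew_product (measurable_from_prod_countable_left he)
      (ae_of_all _ fun y => map_count_perm (e y))
  exact (Measure.measurePreserving_swap.comp hskew).comp Measure.measurePreserving_swap

/-- The indicator function of `{t} × Y` in `L²(Γ × Y)`. -/
def fibreIndicator (ν : Measure Y) [IsProbabilityMeasure ν] (t : Γ) : HilbertSpace Γ ν :=
  indicatorConstLp 2 (s := {t} ×ˢ (Set.univ : Set Y))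
    ((measurableSet_singleton t).prod MeasurableSet.univ)
    (by simp) (1 : ℂ)

theorem coeFn_fibreIndicator [IsProbabilityMeasure ν] (t : Γ) :
    fibreIndicator ν t =ᵐ[countProd Γ ν]
      fun z => Set.indicator {t} (fun _ => (1 : ℂ)) z.1 := by
  refine indicatorConstLp_coeFn.trans (ae_of_all _ fun z => ?_)
  beta_reduce
  by_cases hz : z.1 = t
  · rw [Set.indicator_of_mem (by simpa using hz), Set.indicator_of_mem (by simpa using hz)]
  · rw [Set.indicator_of_notMem (by simpa using hz), Set.indicator_of_notMem (by simpa using hz)]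

/-- If `ξ ↦ ξ ∘ θ₀ + ξ ∘ θ₁` commutes with the multiplication by `F`, where `θ₀` preserves each
`{t} × Y` and `θ₁` moves every point which it does not fix out of its fibre, then `F` is
`θ₀`-invariant. -/
theorem ae_eq_of_add_compOp_commute_mulOp [IsProbabilityMeasure ν] {θ₀ θ₁ : Γ × Y → Γ × Y}
    (h₀ : MeasurePreserving θ₀ (countProd Γ ν) (countProd Γ ν))
    (h₁ : MeasurePreserving θ₁ (countProd Γ ν) (countProd Γ ν))
    {F : Lp ℂ ∞ (countProd Γ ν)}
    (hfib : ∀ z, (θ₀ z).1 = z.1) (hmov : ∀ z, θ₀ z = z ∨ (θ₁ z).1 ≠ z.1)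
    (h : (compOp θ₀ h₀ + compOp θ₁ h₁) * mulOp F = mulOp F * (compOp θ₀ h₀ + compOp θ₁ h₁)) :
    ∀ᵐ z ∂countProd Γ ν, F (θ₀ z) = F z := by
  -- `Γ` is countable, so each fibre can be treated separately, by applying the commutation relation
  -- to its indicator.
  have hall : ∀ᵐ z ∂countProd Γ ν, ∀ t : Γ, z.1 = t → F (θ₀ z) = F z := by
    rw [ae_all_iff]
    intro t
    have ht : compOp θ₀ h₀ (mulOp F (fibreIndicator ν t)) +
        compOp θ₁ h₁ (mulOp F (fibreIndicator ν t)) =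
        mulOp F (compOp θ₀ h₀ (fibreIndicator ν t) + compOp θ₁ h₁ (fibreIndicator ν t)) :=
      congrArg (fun T => T (fibreIndicator ν t)) h
    have hI := coeFn_fibreIndicator (ν := ν) t
    have hM := coeFn_mulOp F (fibreIndicator ν t)
    filter_upwards [Lp.coeFn_add (compOp θ₀ h₀ (mulOp F (fibreIndicator ν t)))
        (compOp θ₁ h₁ (mulOp F (fibreIndicator ν t))),
      coeFn_mulOp F (compOp θ₀ h₀ (fibreIndicator ν t) + compOp θ₁ h₁ (fibreIndicator ν t)),
      Lp.coeFn_add (compOp θ₀ h₀ (fibreIndicator ν t)) (compOp θ₁ h₁ (fibreIndicator ν t)),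
      coeFn_compOp h₀ (mulOp F (fibreIndicator ν t)),
      coeFn_compOp h₁ (mulOp F (fibreIndicator ν t)),
      coeFn_compOp h₀ (fibreIndicator ν t), coeFn_compOp h₁ (fibreIndicator ν t),
      h₀.quasiMeasurePreserving.ae hI, h₁.quasiMeasurePreserving.ae hI,
      h₀.quasiMeasurePreserving.ae hM, h₁.quasiMeasurePreserving.ae hM]
      with z a1 a2 a3 a4 a5 a6 a7 a8 a9 a10 a11 hz
    rcases hmov z with h' | h'
    · rw [h']
    · rw [ht, a2, a3] at a1
      simp only [Pi.add_apply] at a1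
      rw [a4, a5, a6, a7, a10, a11, a8, a9] at a1
      -- At a point of the fibre over `t` which θ₁ moves out of it, both θ₁ terms vanish and the θ₀
      -- terms give the claim.
      have e0 : (θ₀ z).1 = t := (hfib z).trans hz
      have e1 : (θ₁ z).1 ≠ t := fun e => h' (e.trans hz.symm)
      simpa [e0, e1] using a1.symm
  filter_upwards [hall] with z hz using hz _ rfl

variable [Group Γ] [SFinite ν]

theorem compOp_commute_translationOp {θ : Γ × Y → Γ × Y}
    (hθ : MeasurePreserving θ (countProd Γ ν) (countProd Γ ν))
    (h : ∀ (r : Γ) (z : Γ × Y), θ (r * z.1, z.2) = (r * (θ z).1, (θ z).2)) (r : Γ) :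
    compOp θ hθ * translationOp ν r = translationOp ν r * compOp θ hθ := by
  have hr : translationOp ν r = compOp _ (measurePreserving_translate ν r) := rfl
  rw [hr, compOp_mul_compOp hθ _ (hθ.comp (measurePreserving_translate ν r)) fun z => ?_,
    compOp_mul_compOp _ hθ (hθ.comp (measurePreserving_translate ν r)) fun z => rfl]
  exact (h r⁻¹ z).symm

variable [MulAction Γ Y]

theorem quasiMeasurePreserving_smul (hν : IsNonsingular Γ ν) :
    Measure.QuasiMeasurePreserving (fun z : Γ × Y => z.1 • z.2)
      (countProd Γ ν) ν :=
  QuasiMeasurePreserving.prod_of_right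
    (measurable_from_prod_countable_right fun t => (hν t).measurable)
    (ae_of_all _ fun t => hν t)

/-- The composition operator of a map `(t, y) ↦ (c (t • y) t, y)` belongs to the crossed product
`L^∞(Y) ⋊ Γ`. -/
theorem compOp_mem_crossedProduct (hν : IsNonsingular Γ ν) {c : Y → Γ} (hc : Measurable c)
    (hφ : MeasurePreserving (fun z : Γ × Y => (c (z.1 • z.2) * z.1, z.2))
      (countProd Γ ν) (countProd Γ ν)) :
    compOp _ hφ ∈ crossedProduct Γ ν Set.univ := by
  refine mem_generated_iff.2 fun V hV => ?_
  have hS := (StarSubalgebra.mem_centralizer_iff ℂ).1 hV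
  have hsm := quasiMeasurePreserving_smul hν
  have hmeas (γ : Γ) : MeasurableSet (c ⁻¹' {γ}) := hc (measurableSet_singleton γ)
  -- These sets partition `Γ × Y`; on `A γ` the operator agrees with the translation by `γ⁻¹`, so
  -- anything commuting with `L^∞(Y)` and the translations commutes with it piece by piece.
  let A (γ : Γ) : Set (Γ × Y) := (fun z : Γ × Y => z.1 • z.2) ⁻¹' (c ⁻¹' {γ})
  have hA (γ : Γ) : MeasurableSet (A γ) := hsm.measurable (hmeas γ)
  let F (γ : Γ) : Lp ℂ ∞ (countProd Γ ν) := (memLp_top_indicator_one (countProd Γ ν) (hA γ)).toLp _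
  have hF (γ : Γ) : F γ =ᵐ[countProd Γ ν] (A γ).indicator fun _ => 1 := MemLp.coeFn_toLp _
  have hFmem (γ : Γ) : mulOp (F γ) * V = V * mulOp (F γ) := by
    refine (hS _ (Or.inl ⟨(memLp_top_indicator_one ν (hmeas γ)).toLp _, trivial, F γ, ?_, rfl⟩)).1
    filter_upwards [hF γ, hsm.ae (MemLp.coeFn_toLp (memLp_top_indicator_one ν (hmeas γ)))]
      with z h1 h2
    rw [h1, h2]; rfl
  have hcut (γ : Γ) :
      mulOp (F γ) * compOp _ hφ = mulOp (F γ) * translationOp ν γ⁻¹ := by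
    ext1 ξ
    apply Lp.ext
    change (mulOp (F γ) (compOp _ hφ ξ) : Γ × Y → ℂ) =ᵐ[countProd Γ ν]
      (mulOp (F γ) (compOp _ (measurePreserving_translate ν γ⁻¹) ξ) : Γ × Y → ℂ)
    filter_upwards [coeFn_mulOp (F γ) (compOp _ hφ ξ),
      coeFn_mulOp (F γ) (compOp _ (measurePreserving_translate ν γ⁻¹) ξ), coeFn_compOp hφ ξ,
      coeFn_compOp (measurePreserving_translate ν γ⁻¹) ξ, hF γ] with z h1 h2 h3 h4 h5
    rw [h1, h2, h3, h4, h5]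
    by_cases hz : z ∈ A γ
    · have : c (z.1 • z.2) = γ := hz
      rw [this, inv_inv]
    · simp [hz]
  have hu (γ : Γ) : translationOp ν γ * V = V * translationOp ν γ := (hS _ (Or.inr ⟨γ, rfl⟩)).1
  have hkey (γ : Γ) : mulOp (F γ) * (V * compOp _ hφ) = mulOp (F γ) * (compOp _ hφ * V) := by
    rw [← mul_assoc, ← mul_assoc, hFmem, mul_assoc, hcut, ← mul_assoc, ← hFmem, mul_assoc, ← hu,
      mul_assoc]
  ext1 ξ
  apply Lp.ext
  have hall : ∀ᵐ z ∂countProd Γ ν, ∀ γ, z ∈ A γ →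
      (V * compOp _ hφ) ξ z = (compOp _ hφ * V) ξ z := by
    rw [ae_all_iff]
    intro γ
    filter_upwards [coeFn_mulOp (F γ) ((V * compOp _ hφ) ξ),
      coeFn_mulOp (F γ) ((compOp _ hφ * V) ξ), hF γ] with z h1 h2 h3 hz
    have h0 : mulOp (F γ) ((V * compOp _ hφ) ξ) = mulOp (F γ) ((compOp _ hφ * V) ξ) :=
      congrArg (fun T => T ξ) (hkey γ)
    rw [h0, h2, h3] at h1
    simpa [hz] using h1.symm
  filter_upwards [hall] with z hz using hz _ rfl

end Fibred

/-! ### A free extension of a non-singular action -/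

section Extension

/-- A permutation of `Γ` inverting the right translation by `s`: it inverts the second factor in a
decomposition of `Γ` as a product of a set of coset representatives and the cyclic group of `s`. -/
theorem exists_perm_mul_right_inv {Γ : Type u} [Group Γ] (s : Γ) :
    ∃ J : Equiv.Perm Γ, ∀ z, J (z * s) = J z * s⁻¹ := by
  let r : Γ → Γ := fun z => (z : Γ ⧸ Subgroup.zpowers s).out
  have hr (z : Γ) : ∃ n : ℤ, s ^ n = (r z)⁻¹ * z := by
    have : (r z)⁻¹ * z ∈ Subgroup.zpowers s := QuotientGroup.eq.1 (QuotientGroup.out_eq' _)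
    exact Subgroup.mem_zpowers_iff.1 this
  have hrr (z h : Γ) (hh : h ∈ Subgroup.zpowers s) : r (z * h) = r z := by
    have : ((z * h : Γ) : Γ ⧸ Subgroup.zpowers s) = z :=
      (QuotientGroup.eq.2 (by simpa using hh)).symm
    simp only [r, this]
  -- For `z = r z * s ^ n` this expression equals `r z * s ^ (-n)`.
  have hinv : Function.Involutive fun z => r z * z⁻¹ * r z := by
    intro z
    obtain ⟨n, hn⟩ := hr z
    have h1 : r z * z⁻¹ * r z = z * (s ^ n)⁻¹ * (s ^ n)⁻¹ := by rw [hn]; group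
    have h2 : r (r z * z⁻¹ * r z) = r z := by
      rw [h1, mul_assoc]
      exact hrr _ _ (mul_mem (inv_mem (Subgroup.zpow_mem_zpowers s n))
        (inv_mem (Subgroup.zpow_mem_zpowers s n)))
    simp only [h2]
    group
  refine ⟨hinv.toPerm, fun z => ?_⟩
  obtain ⟨n, hn⟩ := hr z
  have hz : z = r z * s ^ n := by rw [hn]; group
  change r (z * s) * (z * s)⁻¹ * r (z * s) = r z * z⁻¹ * r z * s⁻¹
  rw [hrr _ _ (Subgroup.mem_zpowers s)]
  have h3 : z⁻¹ * r z = (s ^ n)⁻¹ := by rw [hn]; group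
  rw [mul_inv_rev, mul_assoc, mul_assoc, h3, mul_assoc (r z) z⁻¹, h3, mul_assoc]
  group

variable {Γ : Type u} [Group Γ] {X : Type v}

variable (Γ X) in
/-- The underlying space of the extension. -/
abbrev Extension : Type (max u v) := (X × Γ) × Bool

/-- The action of `Γ` on the extension, by left translation of the middle factor. -/
abbrev extensionAction : MulAction Γ (Extension Γ X) where
  smul g y := ((y.1.1, g * y.1.2), y.2)
  one_smul y := by
    change ((y.1.1, 1 * y.1.2), y.2) = y
    rw [one_mul]
  mul_smul g h y := by
    change ((y.1.1, g * h * y.1.2), y.2) = ((y.1.1, g * (h * y.1.2)), y.2)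
    rw [mul_assoc]

attribute [local instance] extensionAction

theorem extension_smul_def (g : Γ) (y : Extension Γ X) : g • y = ((y.1.1, g * y.1.2), y.2) := rfl

/-- The projection of the extension onto `X`. -/
def extensionProj [MulAction Γ X] (y : Extension Γ X) : X := y.1.2 • y.1.1

/-! ### Transformations of the extension -/

section Maps

variable (F : Set X) (s : Γ)

open Classical in
/-- The map of the extension exchanging the two sheets over `F`. -/
def flip (y : Extension Γ X) : Extension Γ X := (y.1, if y.1.1 ∈ F then !y.2 else y.2)

open Classical in
/-- The group element by which `twistedFlip` translates. -/
def twist (y : Extension Γ X) : Γ :=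
  if y.1.1 ∈ F then y.1.2 * (if y.2 then s⁻¹ else s) * y.1.2⁻¹ else 1

/-- The map of `Γ × Y` exchanging the two sheets over `F`. -/
def sheetFlip (z : Γ × Extension Γ X) : Γ × Extension Γ X := (z.1, flip F z.2)

/-- The map of `Γ × Y` exchanging the two sheets over `F` and translating by `s` in the process. -/
def twistedFlip (z : Γ × Extension Γ X) : Γ × Extension Γ X := (z.1 * twist F s z.2, flip F z.2)

/-- The cocycle of the element of the full group which conjugates `sheetFlip` to `twistedFlip`. -/
def cocycle (J : Equiv.Perm Γ) (y : Extension Γ X) : Γ :=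
  J y.1.2 * (if y.2 then s else 1) * y.1.2⁻¹

/-- The transformation of `Γ × Y` conjugating `sheetFlip` to `twistedFlip`. -/
def conjugator (J : Equiv.Perm Γ) (z : Γ × Extension Γ X) : Γ × Extension Γ X :=
  (cocycle s J (z.1 • z.2) * z.1, z.2)

theorem conjugator_apply (J : Equiv.Perm Γ) (t y : Γ) (x : X) (i : Bool) :
    conjugator s J (t, ((x, y), i)) =
      (J (t * y) * (if i then s else 1) * y⁻¹, ((x, y), i)) := by
  refine Prod.ext ?_ rfl
  change J (t * y) * (if i then s else 1) * (t * y)⁻¹ * t = _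
  group

variable {F s}

theorem involutive_sheetFlip : Function.Involutive (sheetFlip (Γ := Γ) F) := by
  rintro ⟨t, ⟨x, y⟩, i⟩
  by_cases h : x ∈ F <;> simp [sheetFlip, flip, h]

/-- The exponent of `s` depends on the sheet, so the second application undoes the translation made
by the first. -/
theorem involutive_twistedFlip : Function.Involutive (twistedFlip F s) := by
  rintro ⟨t, ⟨x, y⟩, i⟩
  by_cases h : x ∈ F <;> cases i <;> simp [twistedFlip, twist, flip, h, mul_assoc]

variable {J : Equiv.Perm Γ}

/-- The conjugator puts a factor `s` on the sheet `true` only, so changing sheets costs the factor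
`s` or `s⁻¹` recorded by `twist`. -/
theorem conjugator_sheetFlip (z : Γ × Extension Γ X) :
    conjugator s J (sheetFlip F z) = twistedFlip F s (conjugator s J z) := by
  obtain ⟨t, ⟨x, y⟩, i⟩ := z
  by_cases h : x ∈ F <;> cases i <;>
    simp [twistedFlip, twist, sheetFlip, flip, conjugator_apply, h, mul_assoc]

/-- Here `J` turns the translation by `s` or `s⁻¹` into its inverse, which the factor attached to
the new sheet compensates. This is why `J` must invert right translation by `s`. -/
theorem conjugator_twistedFlip (hJ : ∀ z, J (z * s) = J z * s⁻¹) (z : Γ × Extension Γ X) :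
    conjugator s J (twistedFlip F s z) = sheetFlip F (conjugator s J z) := by
  have hJ' (z : Γ) : J (z * s⁻¹) = J z * s := by simpa using (congrArg (· * s) (hJ (z * s⁻¹))).symm
  obtain ⟨t, ⟨x, y⟩, i⟩ := z
  by_cases h : x ∈ F <;> cases i <;>
    simp [twistedFlip, twist, sheetFlip, flip, conjugator_apply, h, ← mul_assoc, hJ, hJ']

theorem fst_conjugator_sheetFlip_ne (hs : s ≠ 1) {z : Γ × Extension Γ X} (hz : z.2.1.1 ∈ F) :
    (conjugator s J (sheetFlip F z)).1 ≠ (sheetFlip F (conjugator s J z)).1 := by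
  obtain ⟨t, ⟨x, y⟩, i⟩ := z
  replace hz : x ∈ F := hz
  cases i <;> simp [sheetFlip, flip, conjugator_apply, hz, hs]

theorem fst_twistedFlip_ne (hs : s ≠ 1) (z : Γ × Extension Γ X) :
    sheetFlip F z = z ∨ (twistedFlip F s z).1 ≠ z.1 := by
  obtain ⟨t, ⟨x, y⟩, i⟩ := z
  by_cases h : x ∈ F
  · right
    cases i <;> simp [twistedFlip, twist, h, hs, mul_inv_eq_one]
  · left
    simp [sheetFlip, flip, h]

end Maps

/-! ### The measure of the extension -/

/-- The uniform probability measure on `Bool`. -/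
def coin : Measure Bool := (2⁻¹ : ℝ≥0∞) • Measure.count

instance : IsProbabilityMeasure coin := ⟨by
  rw [coin, Measure.smul_apply, Measure.count_univ, smul_eq_mul, ENat.card_eq_coe_fintype_card,
    Fintype.card_bool]
  exact ENNReal.inv_mul_cancel (by norm_num) (by norm_num)⟩

theorem map_coin (e : Equiv.Perm Bool) : coin.map e = coin := by
  rw [coin, Measure.map_smul, map_count_perm]

variable [MeasurableSpace Γ] [DiscreteMeasurableSpace Γ] [Countable Γ] [MeasurableSpace X]

variable (Γ) in
/-- The measure on the extension. -/
def extensionMeasure (μ : Measure X) : Measure (Extension Γ X) :=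
  (μ.prod (Measure.count : Measure Γ).toFinite).prod coin

variable {μ : Measure X} [IsProbabilityMeasure μ]

instance : IsProbabilityMeasure (Measure.count : Measure Γ).toFinite := by
  have : NeZero (Measure.count : Measure Γ) := ⟨by simp⟩
  infer_instance

instance : IsProbabilityMeasure (extensionMeasure Γ μ) := by
  unfold extensionMeasure
  infer_instance

/-- The finite measure is equivalent to counting measure, so translations of `Γ` are trivially
non-singular for it. -/
theorem toFinite_count_eq_zero_iff {A : Set Γ} :
    (Measure.count : Measure Γ).toFinite A = 0 ↔ A = ∅ := by
  rw [toFinite_apply_eq_zero_iff, Measure.count_eq_zero_iff]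

theorem isNonsingular_extension : IsNonsingular Γ (extensionMeasure Γ μ) := by
  intro g
  have hg : Measure.QuasiMeasurePreserving (fun t : Γ => g * t)
      (Measure.count : Measure Γ).toFinite (Measure.count : Measure Γ).toFinite := by
    refine ⟨.of_discrete, Measure.AbsolutelyContinuous.mk fun A hA h => ?_⟩
    rw [toFinite_count_eq_zero_iff] at h
    simp [h]
  exact QuasiMeasurePreserving.prodMap (QuasiMeasurePreserving.prodMap (.id μ) hg) (.id coin)

theorem isEssentiallyFree_extension : IsEssentiallyFree Γ (extensionMeasure Γ μ) := by
  intro g hg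
  have : {y : Extension Γ X | g • y = y} = ∅ := by
    ext y
    simp only [Set.mem_ofPred_eq, Set.mem_empty_iff_false, iff_false, extension_smul_def]
    intro h
    exact hg (by simpa using congrArg (fun y : Extension Γ X => y.1.2) h)
  rw [this, measure_empty]

theorem isFactorMap_extensionProj [MulAction Γ X] (hμ : IsNonsingular Γ μ) :
    IsFactorMap Γ extensionProj (extensionMeasure Γ μ) μ := by
  have hm : Measurable (fun y : X × Γ => y.2 • y.1) :=
    measurable_from_prod_countable_left fun t => (hμ t).measurable
  have hq : Measure.QuasiMeasurePreserving (fun y : X × Γ => y.2 • y.1)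
      (μ.prod (Measure.count : Measure Γ).toFinite) μ :=
    QuasiMeasurePreserving.prod_of_left hm (ae_of_all _ fun t => hμ t)
  have hq' : Measure.QuasiMeasurePreserving (extensionProj : Extension Γ X → X)
      (extensionMeasure Γ μ) μ := hq.comp Measure.quasiMeasurePreserving_fst
  refine ⟨hq'.measurable, hq'.absolutelyContinuous, ?_, fun g => ae_of_all _ fun y => ?_⟩
  · refine Measure.AbsolutelyContinuous.mk fun A hA h => ?_
    rw [Measure.map_apply hq'.measurable hA] at h
    have hpre : (extensionProj : Extension Γ X → X) ⁻¹' A =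
        ((fun y : X × Γ => y.2 • y.1) ⁻¹' A) ×ˢ Set.univ := by
      ext y; simp [extensionProj]
    rw [hpre, extensionMeasure, Measure.prod_prod, measure_univ, mul_one] at h
    -- On the slice over `1 ∈ Γ`, which has positive mass, the projection is the identity of `X`.
    have hsub : A ×ˢ ({1} : Set Γ) ⊆ (fun y : X × Γ => y.2 • y.1) ⁻¹' A := by
      rintro ⟨x, t⟩ ⟨hx, ht⟩
      obtain rfl : t = 1 := ht
      simpa using hx
    have h0 := measure_mono_null hsub h
    rw [Measure.prod_prod, mul_eq_zero, toFinite_count_eq_zero_iff] at h0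
    simpa using h0
  · exact mul_smul g y.1.2 y.1.1

variable {F : Set X} {s : Γ} {J : Equiv.Perm Γ}

theorem measurePreserving_flip (hF : MeasurableSet F) :
    MeasurePreserving (flip F) (extensionMeasure Γ μ) (extensionMeasure Γ μ) := by
  classical
  have hbm : MeasurableSet {y : X × Γ | y.1 ∈ F} := measurable_fst hF
  refine (MeasurePreserving.id (μ.prod (Measure.count : Measure Γ).toFinite)).skew_product
    (g := fun y i => if y.1 ∈ F then !i else i) ?_ (ae_of_all _ fun y => ?_)
  · refine measurable_from_prod_countable_left fun i => ?_
    exact Measurable.ite hbm (measurable_const (a := !i)) (measurable_const (a := i))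
  · by_cases h : y.1 ∈ F
    · simp only [h, if_true]
      exact map_coin Equiv.boolNot
    · simp only [h, if_false]
      exact map_coin (Equiv.refl _)

theorem measurePreserving_sheetFlip (hF : MeasurableSet F) :
    MeasurePreserving (sheetFlip F) (countProd Γ (extensionMeasure Γ μ))
      (countProd Γ (extensionMeasure Γ μ)) :=
  measurePreserving_fibred (measurePreserving_flip hF) (fun _ => 1) fun _ => measurable_const

theorem measurable_twist (hF : MeasurableSet F) : Measurable (twist F s) := by
  classical
  refine Measurable.ite (measurable_fst.fst hF) ?_ measurable_const
  exact (Measurable.of_discrete (f := fun p : Γ × Bool =>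
    p.1 * (if p.2 then s⁻¹ else s) * p.1⁻¹)).comp (measurable_fst.snd.prodMk measurable_snd)

theorem measurePreserving_twistedFlip (hF : MeasurableSet F) :
    MeasurePreserving (twistedFlip F s) (countProd Γ (extensionMeasure Γ μ))
      (countProd Γ (extensionMeasure Γ μ)) :=
  measurePreserving_fibred (measurePreserving_flip hF) (fun y => Equiv.mulRight (twist F s y))
    fun t => (Measurable.of_discrete (f := fun r : Γ => t * r)).comp (measurable_twist hF)

theorem measurable_cocycle : Measurable (cocycle (X := X) s J) :=
  (Measurable.of_discrete (f := fun p : Γ × Bool =>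
    J p.1 * (if p.2 then s else 1) * p.1⁻¹)).comp (measurable_fst.snd.prodMk measurable_snd)

theorem measurePreserving_conjugator :
    MeasurePreserving (conjugator s J) (countProd Γ (extensionMeasure Γ μ))
      (countProd Γ (extensionMeasure Γ μ)) := by
  let e (y : Extension Γ X) : Equiv.Perm Γ := ((Equiv.mulRight y.1.2).trans J).trans
    (Equiv.mulRight ((if y.2 then s else 1) * y.1.2⁻¹))
  have h := measurePreserving_fibred (MeasurePreserving.id (extensionMeasure Γ μ)) e fun t =>
    (Measurable.of_discrete (f := fun p : Γ × Bool =>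
      J (t * p.1) * ((if p.2 then s else 1) * p.1⁻¹))).comp
        (measurable_fst.snd.prodMk measurable_snd)
  convert! h using 1
  ext1 z
  rw [conjugator_apply, mul_assoc]
  rfl

/-- The von Neumann algebra generated by `L^∞(X) ⋊ Γ` and the composition operator of the
conjugator. -/
def intermediateAlgebra [MulAction Γ X] (μ : Measure X) [IsProbabilityMeasure μ] (s : Γ)
    (J : Equiv.Perm Γ) : VonNeumannAlgebra (HilbertSpace Γ (extensionMeasure Γ μ)) :=
  generated (insert (compOp (conjugator s J) measurePreserving_conjugator)
    (coefficientOps Γ (extensionMeasure Γ μ)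
      (pullbackLinfty (extensionMeasure Γ μ) μ extensionProj) ∪
      Set.range (translationOp (extensionMeasure Γ μ))))

/-! ### The intermediate algebra and its commutant. -/

section Intermediate

variable [MulAction Γ X]

theorem le_intermediateAlgebra :
    crossedProduct Γ (extensionMeasure Γ μ)
      (pullbackLinfty (extensionMeasure Γ μ) μ extensionProj) ≤ intermediateAlgebra μ s J :=
  generated_mono (Set.subset_insert _ _)

theorem intermediateAlgebra_le :
    intermediateAlgebra μ s J ≤ crossedProduct Γ (extensionMeasure Γ μ) Set.univ := by
  refine generated_le_generated ?_
  rintro x (rfl | ⟨g, -, F, hF, rfl⟩ | hx)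
  · exact compOp_mem_crossedProduct isNonsingular_extension measurable_cocycle _
  · exact subset_generated _ (Or.inl ⟨g, trivial, F, hF, rfl⟩)
  · exact subset_generated _ (Or.inr hx)

/-- The sum of the composition operators of `sheetFlip` and `twistedFlip`, for a set `F` of points
fixed by `s`, commutes with the intermediate algebra. -/
theorem commute_intermediateAlgebra (hF : MeasurableSet F)
    (hfix : ∀ x ∈ F, s • x = x) (hJ : ∀ z, J (z * s) = J z * s⁻¹)
    {T : HilbertSpace Γ (extensionMeasure Γ μ) →L[ℂ] HilbertSpace Γ (extensionMeasure Γ μ)}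
    (hT : T ∈ intermediateAlgebra μ s J) :
    (compOp (sheetFlip F) (measurePreserving_sheetFlip hF) +
      compOp (twistedFlip F s) (measurePreserving_twistedFlip hF)) * T =
    T * (compOp (sheetFlip F) (measurePreserving_sheetFlip hF) +
      compOp (twistedFlip F s) (measurePreserving_twistedFlip hF)) := by
  have h₀ : MeasurePreserving (sheetFlip F) (countProd Γ (extensionMeasure Γ μ))
      (countProd Γ (extensionMeasure Γ μ)) :=
    measurePreserving_sheetFlip hF
  have h₁ : MeasurePreserving (twistedFlip F s) (countProd Γ (extensionMeasure Γ μ))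
      (countProd Γ (extensionMeasure Γ μ)) :=
    measurePreserving_twistedFlip hF
  have hc : MeasurePreserving (conjugator s J) (countProd Γ (extensionMeasure Γ μ))
      (countProd Γ (extensionMeasure Γ μ)) :=
    measurePreserving_conjugator
  refine commute_of_mem_generated ((isSelfAdjoint_compOp _ involutive_sheetFlip).add
    (isSelfAdjoint_compOp _ involutive_twistedFlip)) ?_ hT
  rintro x (rfl | ⟨g, ⟨f, hf⟩, G, hG, rfl⟩ | ⟨r, rfl⟩)
  -- Moving the conjugator across exchanges the two summands, so only their sum commutes with it.
  · rw [add_mul, mul_add, compOp_mul_compOp h₀ hc (hc.comp h₀) fun _ => rfl,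
      compOp_mul_compOp h₁ hc (hc.comp h₁) fun _ => rfl,
      compOp_mul_compOp hc h₀ (hc.comp h₁) fun z => (conjugator_twistedFlip hJ z).symm,
      compOp_mul_compOp hc h₁ (hc.comp h₀) fun z => (conjugator_sheetFlip z).symm, add_comm]
  · have hGf : ∀ᵐ z ∂countProd Γ (extensionMeasure Γ μ), G z = f ((z.1 * z.2.1.2) • z.2.1.1) := by
      filter_upwards [hG, (quasiMeasurePreserving_smul isNonsingular_extension).ae hf]
        with z h1 h2
      rw [h1, h2]; rfl
    have hfix' (x : X) (hx : x ∈ F) : s⁻¹ • x = x := by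
      rw [inv_smul_eq_iff, hfix x hx]
    rw [add_mul, mul_add, compOp_commute_mulOp, compOp_commute_mulOp]
    -- Over `F` the product `t * y` gains a factor `s` or `s⁻¹` on the right, which acts trivially
    -- on `x`.
    · filter_upwards [hGf, h₁.quasiMeasurePreserving.ae hGf] with z h1 h2
      rw [h1, h2]
      obtain ⟨t, ⟨x, y⟩, i⟩ := z
      by_cases h : x ∈ F <;> cases i <;>
        simp [twistedFlip, twist, flip, h, mul_smul, hfix, hfix']
    · filter_upwards [hGf, h₀.quasiMeasurePreserving.ae hGf] with z h1 h2
      rw [h1, h2]; rfl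
  · rw [add_mul, mul_add, compOp_commute_translationOp h₀ (fun _ _ => rfl),
      compOp_commute_translationOp h₁ fun r z => ?_]
    simp [twistedFlip, mul_assoc]

/-- If a set `F` of positive measure is fixed pointwise by `s ≠ 1`, then the intermediate algebra is
not a crossed product. -/
theorem intermediateAlgebra_ne_crossedProduct (hs : s ≠ 1)
    (hF : MeasurableSet F) (hfix : ∀ x ∈ F, s • x = x) (hF0 : μ F ≠ 0)
    (hJ : ∀ z, J (z * s) = J z * s⁻¹) (N : Set (Lp ℂ ∞ (extensionMeasure Γ μ))) :
    intermediateAlgebra μ s J ≠ crossedProduct Γ (extensionMeasure Γ μ) N := by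
  intro heq
  have h₀ : MeasurePreserving (sheetFlip F) (countProd Γ (extensionMeasure Γ μ))
      (countProd Γ (extensionMeasure Γ μ)) :=
    measurePreserving_sheetFlip hF
  have hc : MeasurePreserving (conjugator s J) (countProd Γ (extensionMeasure Γ μ))
      (countProd Γ (extensionMeasure Γ μ)) :=
    measurePreserving_conjugator
  have hmem : compOp (conjugator s J) hc ∈ crossedProduct Γ (extensionMeasure Γ μ) N := by
    rw [← heq]
    exact subset_generated _ (Set.mem_insert _ _)
  have hcomm : compOp (sheetFlip F) h₀ * compOp (conjugator s J) hc =
      compOp (conjugator s J) hc * compOp (sheetFlip F) h₀ := by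
    refine commute_of_mem_generated (isSelfAdjoint_compOp _ involutive_sheetFlip) ?_ hmem
    rintro x (hx | ⟨r, rfl⟩)
    -- A coefficient operator in `M` commutes with the sum, hence with the sheet flip alone.
    · have hx' : x ∈ intermediateAlgebra μ s J := by
        rw [heq]
        exact subset_generated _ (Or.inl hx)
      obtain ⟨g, -, G, -, rfl⟩ := hx
      exact compOp_commute_mulOp h₀ (ae_eq_of_add_compOp_commute_mulOp _ _ (fun _ => rfl)
        (fst_twistedFlip_ne hs) (commute_intermediateAlgebra hF hfix hJ hx'))
    · exact compOp_commute_translationOp h₀ (fun _ _ => rfl) r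
  rw [compOp_mul_compOp h₀ hc (hc.comp h₀) fun _ => rfl,
    compOp_mul_compOp hc h₀ (h₀.comp hc) fun _ => rfl] at hcomm
  -- Applied to fibre indicators, the operator identity forces the two composites to have the same
  -- `Γ`-coordinate almost everywhere.
  have hall : ∀ᵐ z ∂countProd Γ (extensionMeasure Γ μ), ∀ t : Γ,
      (conjugator s J (sheetFlip F z)).1 = t →
      (sheetFlip F (conjugator s J z)).1 = t := by
    rw [ae_all_iff]
    intro t
    have hI := coeFn_fibreIndicator (ν := extensionMeasure Γ μ) t
    filter_upwards [coeFn_compOp (hc.comp h₀) (fibreIndicator (extensionMeasure Γ μ) t),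
      coeFn_compOp (h₀.comp hc) (fibreIndicator (extensionMeasure Γ μ) t),
      (hc.comp h₀).quasiMeasurePreserving.ae hI,
      (h₀.comp hc).quasiMeasurePreserving.ae hI] with z a1 a2 a3 a4 hz
    rw [hcomm, a2, a3, a4] at a1
    by_contra hne
    simp [hz, hne] at a1
  have hnull : ∀ᵐ z ∂countProd Γ (extensionMeasure Γ μ), z.2.1.1 ∉ F := by
    filter_upwards [hall] with z hz hzF
    exact fst_conjugator_sheetFlip_ne (J := J) hs hzF (hz _ rfl).symm
  have hset : {z : Γ × Extension Γ X | ¬ z.2.1.1 ∉ F} =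
      Set.univ ×ˢ ((F ×ˢ Set.univ) ×ˢ Set.univ) := by
    ext z; simp
  rw [ae_iff, hset, extensionMeasure, Measure.prod_prod, Measure.prod_prod, Measure.prod_prod,
    measure_univ (μ := coin)] at hnull
  simp [hF0] at hnull

end Intermediate

end Extension

end CrossedProduct

end

open CrossedProduct
theorem proposition3p9
    {Γ : Type u} [Group Γ] [Countable Γ] [MeasurableSpace Γ] [DiscreteMeasurableSpace Γ]
    {X : Type v} [MeasurableSpace X] [StandardBorelSpace X] [MulAction Γ X]
    (μ : Measure X) [IsProbabilityMeasure μ]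
    (hα : IsNonsingular Γ μ) (hα_nonfree : ¬ IsEssentiallyFree Γ μ) :
    ∃ (Y : Type (max u v)) (_ : MeasurableSpace Y) (_ : StandardBorelSpace Y) (_ : MulAction Γ Y)
      (ν : Measure Y) (_ : IsProbabilityMeasure ν) (π : Y → X),
      IsNonsingular Γ ν ∧ IsEssentiallyFree Γ ν ∧ IsFactorMap Γ π ν μ ∧
      ∃ M : VonNeumannAlgebra (HilbertSpace Γ ν),
        crossedProduct Γ ν (pullbackLinfty ν μ π) ≤ M ∧
        M ≤ crossedProduct Γ ν Set.univ ∧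
        ∀ (Z : Type w) [MeasurableSpace Z] [StandardBorelSpace Z] [MulAction Γ Z]
          (ζ : Measure Z) [IsProbabilityMeasure ζ] (p : Y → Z) (q : Z → X),
          IsNonsingular Γ ζ → IsFactorMap Γ p ν ζ → IsFactorMap Γ q ζ μ →
          (∀ᵐ y ∂ν, q (p y) = π y) →
          M ≠ crossedProduct Γ ν (pullbackLinfty ν ζ p) := by
  obtain ⟨s, hs, hF0⟩ : ∃ s : Γ, s ≠ 1 ∧ μ {x : X | s • x = x} ≠ 0 := by
    simpa [IsEssentiallyFree] using hα_nonfree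
  have hF : MeasurableSet {x : X | s • x = x} :=
    measurableSet_eq_fun (hα s).measurable measurable_id
  obtain ⟨J, hJ⟩ := exists_perm_mul_right_inv s
  refine ⟨Extension Γ X, inferInstance, inferInstance, extensionAction, extensionMeasure Γ μ,
    inferInstance, extensionProj, isNonsingular_extension, isEssentiallyFree_extension,
    isFactorMap_extensionProj hα, intermediateAlgebra μ s J, le_intermediateAlgebra,
    intermediateAlgebra_le, ?_⟩
  intro Z _ _ _ ζ _ p q _ _ _ _
  -- The obstruction holds for every subset `N` of `L^∞(Y)`, whether or not it comes from an
  -- intermediate extension.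
  exact intermediateAlgebra_ne_crossedProduct hs hF (fun x hx => hx) hF0 hJ _
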